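/- Fix a set $Var$ of variables and a vocabulary of predicate symbols $P$ with arities. A \emph{topo-dependence model} consists of a $T_0$ topological space $(\mathbb D_x,\tau_x)$ for every $x\in Var$, a set $S$ of states, a surjection $\mathbf x:S\to\mathbb D_x$ for every $x\in Var$, and an interpretation $I(P)$ of each $n$-ary $P$ as an $n$-ary relation on $\bigcup_x\mathbb D_x$. It is a \emph{metric} dependence model if every $\tau_x$ is given by a metric. For a finite $X\subseteq Var$ let $\mathbf X(s)=(\mathbf x(s))_{x\in X}$, let $\mathbb D_X=\mathbf X(S)\subseteq\prod_{x\in X}\mathbb D_x$ carry the subspace topology $\tau_X$ of the product topology, and let $\tau_X^S=\{\mathbf X^{-1}(U):U\in\tau_X\}$ be the $X$-topology on $S$. The formulas of $\mathsf{LCD}$ are, with $X,Y$ ranging over finite subsets of $Var$ and $\vec x$ over tuples of variables of the right length, $$\varphi::=P\vec x\mid\neg\varphi\mid\varphi\wedge\varphi\mid D_X\varphi\mid K_X\varphi\mid D_XY\mid K_XY .$$ The language $\mathsf{LKk}$ is obtained by replacing the atoms $K_XY$ of $\mathsf{LCD}$ by atoms $k_XY$. Predicate atoms and Boolean connectives are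 interpreted as usual, and at a state $s$: \begin{itemize} \item $s\models D_X\varphi$ iff $t\models\varphi$ for all $t\in S$ with $\mathbf X(t)=\mathbf X(s)$; \item $s\models K_X\varphi$ iff $s$ is in the interior of $\{t:t\models\varphi\}$ in the $X$-topology; \item $s\models D_XY$ iff $\mathbf Y(t)=\mathbf Y(s)$ for all $t\in S$ with $\mathbf X(t)=\mathbf X(s)$; \item $s\models K_XY$ iff there are $O\in\tau_X^S$ with $s\in O$ and a continuous $F:\mathbf X(O)\to\mathbb D_Y$ such that $F\circ\mathbf X=\mathbf Y$ on $O$; \item $s\models k_XY$ (conditional knowability) iff for every open $U\ni\mathbf Y(s)$ in $\mathbb D_Y$ there is an open $V\ni\mathbf X(s)$ in $\mathbb D_X$ with $\mathbf X^{-1}(V)\subseteq\mathbf Y^{-1}(U)$. \end{itemize} Two formulas are \emph{equivalent} over a class of models if they are true at the same states of all models in the class. $\mathsf{LKk}$ is \emph{more expressive} than $\mathsf{LCD}$ over a class if every $\mathsf{LCD}$ formula is equivalent over the class to an $\mathsf{LKk}$ formula, while some $\mathsf{LKk}$ formula is not equivalent over it to any $\mathsf{LCD}$ formula. \textbf{Proposition.}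 Conditional knowability $k_XY$ is not expressible in $\mathsf{LCD}$: \begin{enumerate} \item for all finite $X,Y\subseteq Var$ with $Y\not\subseteq X$, no $\mathsf{LCD}$ formula is equivalent to $k_XY$ over all topo-dependence models; \item if moreover $X\neq\emptyset$, no $\mathsf{LCD}$ formula is equivalent to $k_XY$ even over the metric dependence models only. \end{enumerate} Consequently $\mathsf{LKk}$ is more expressive than $\mathsf{LCD}$: over all topo-dependence models provided that $Var\neq\emptyset$, and over the metric dependence models provided that $Var$ has at least two elements. -/

import Mathlib

universe u v w

namespace DepLogic

/-- A topo-dependence model over a set `Var` of basic variables and a relational vocabulary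
with arity map `ar`: a `T₀` topological space `D x` of values for each variable `x`, an
interpretation `I` of every predicate symbol as a relation on the union of the value ranges
(each variable has its own type, so the union is a tagged one), a set `State` of abstract
states, and for each `x` an empirical variable, i.e. a surjective map `val x : State → D x`. -/
structure TopoDepModel {Var : Type u} {Pred : Type v} (ar : Pred → ℕ) where
  D : Var → Type w
  top : ∀ x, TopologicalSpace (D x)
  t0 : ∀ x, T0Space (D x)
  I : ∀ P : Pred, Set (Fin (ar P) → Σ x, D x)
  State : Type w
  val : ∀ x, State → D x
  surj : ∀ x, Function.Surjective (val x)

attribute [instance] TopoDepModel.top TopoDepModel.t0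

namespace TopoDepModel

variable {Var : Type u} {Pred : Type v} {ar : Pred → ℕ} (M : TopoDepModel.{u, v, w} (Var := Var) ar)

/-- The range `𝔻_X ⊆ ∏_{x ∈ X} 𝔻_x` of the joint variable `X`; as a subtype of a product it
carries the subspace topology of the product topology. -/
abbrev Range (X : Finset Var) : Type (max u w) :=
  Set.range (fun (s : M.State) (x : X) => M.val x s)

/-- The joint empirical variable `𝐗 : S → 𝔻_X` of a finite set `X` of variables. -/
def joint (X : Finset Var) : M.State → M.Range X :=
  Set.rangeFactorization (fun (s : M.State) (x : X) => M.val x s)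

/-- The `X`-topology on states: its opens are the preimages `𝐗⁻¹(U)` of opens `U` of `𝔻_X`. -/
abbrev stateTop (X : Finset Var) : TopologicalSpace M.State :=
  TopologicalSpace.induced (M.joint X) inferInstance

/-- Truth of the atom `P x₁ … xₙ` at `s`. -/
def HoldsAtom (s : M.State) (P : Pred) (xs : Fin (ar P) → Var) : Prop :=
  (fun i => (⟨xs i, M.val (xs i) s⟩ : Σ x, M.D x)) ∈ M.I P

/-- `s ⊨ D_X Q`: exact determination of a proposition. -/
def Determines (s : M.State) (X : Finset Var) (Q : Set M.State) : Prop :=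
  ∀ t, M.joint X s = M.joint X t → t ∈ Q

/-- `s ⊨ K_X Q`: `s` lies in the interior of `Q` in the `X`-topology. -/
def Knowable (s : M.State) (X : Finset Var) (Q : Set M.State) : Prop :=
  s ∈ @interior M.State (M.stateTop X) Q

/-- `s ⊨ D_X Y`: exact dependence. -/
def ExactDep (s : M.State) (X Y : Finset Var) : Prop :=
  ∀ t, M.joint X s = M.joint X t → M.joint Y s = M.joint Y t

/-- `s ⊨ K_X Y`: on some `X`-open neighbourhood `O` of `s`, `𝐘 = F ∘ 𝐗` for a continuous
`F : 𝐗(O) → 𝔻_Y`. -/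
def EpistemicDep (s : M.State) (X Y : Finset Var) : Prop :=
  ∃ O : Set M.State, @IsOpen M.State (M.stateTop X) O ∧ s ∈ O ∧
    ∃ F : (M.joint X '' O) → M.Range Y, Continuous F ∧
      ∀ (t : M.State) (ht : t ∈ O), F ⟨M.joint X t, Set.mem_image_of_mem _ ht⟩ = M.joint Y t

/-- `s ⊨ k_X Y`: conditional knowability of `Y` given `X` (continuity at a point). -/
def CondKnowable (s : M.State) (X Y : Finset Var) : Prop :=
  ∀ U : Set (M.Range Y), IsOpen U → M.joint Y s ∈ U →
    ∃ V : Set (M.Range X), IsOpen V ∧ M.joint X s ∈ V ∧ M.joint X ⁻¹' V ⊆ M.joint Y ⁻¹' U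

/-- `M` is a metric dependence model: each of its topologies is given by a metric. -/
def IsMetric : Prop := ∀ x, TopologicalSpace.MetrizableSpace (M.D x)

end TopoDepModel

/-- Formulas of the logic of continuous dependence `LCD`:
`P x⃗ | ¬φ | φ ∧ φ | D_X φ | K_X φ | D_X Y | K_X Y`. -/
inductive LCD {Var : Type u} {Pred : Type v} (ar : Pred → ℕ) : Type (max u v)
  | atom (P : Pred) (xs : Fin (ar P) → Var) : LCD ar
  | neg (φ : LCD (Var := Var) ar) : LCD ar
  | and (φ ψ : LCD (Var := Var) ar) : LCD ar
  | det (X : Finset Var) (φ : LCD (Var := Var) ar) : LCD ar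
  | know (X : Finset Var) (φ : LCD (Var := Var) ar) : LCD ar
  | exactDep (X Y : Finset Var) : LCD ar
  | epistemicDep (X Y : Finset Var) : LCD ar

/-- Formulas of `LKk`: those of `LCD` with the atoms `K_X Y` replaced by the atoms `k_X Y`. -/
inductive LKk {Var : Type u} {Pred : Type v} (ar : Pred → ℕ) : Type (max u v)
  | atom (P : Pred) (xs : Fin (ar P) → Var) : LKk ar
  | neg (φ : LKk (Var := Var) ar) : LKk ar
  | and (φ ψ : LKk (Var := Var) ar) : LKk ar
  | det (X : Finset Var) (φ : LKk (Var := Var) ar) : LKk ar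
  | know (X : Finset Var) (φ : LKk (Var := Var) ar) : LKk ar
  | exactDep (X Y : Finset Var) : LKk ar
  | condKnow (X Y : Finset Var) : LKk ar

variable {Var : Type u} {Pred : Type v} {ar : Pred → ℕ}

/-- Truth of an `LCD` formula at a state of a topo-dependence model. -/
def LCD.Sat (M : TopoDepModel.{u, v, w} (Var := Var) ar) : LCD (Var := Var) ar → M.State → Prop
  | .atom P xs, s => M.HoldsAtom s P xs
  | .neg φ, s => ¬ φ.Sat M s
  | .and φ ψ, s => φ.Sat M s ∧ ψ.Sat M s
  | .det X φ, s => M.Determines s X {t | φ.Sat M t}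
  | .know X φ, s => M.Knowable s X {t | φ.Sat M t}
  | .exactDep X Y, s => M.ExactDep s X Y
  | .epistemicDep X Y, s => M.EpistemicDep s X Y

/-- Truth of an `LKk` formula at a state of a topo-dependence model. -/
def LKk.Sat (M : TopoDepModel.{u, v, w} (Var := Var) ar) : LKk (Var := Var) ar → M.State → Prop
  | .atom P xs, s => M.HoldsAtom s P xs
  | .neg φ, s => ¬ φ.Sat M s
  | .and φ ψ, s => φ.Sat M s ∧ ψ.Sat M s
  | .det X φ, s => M.Determines s X {t | φ.Sat M t}
  | .know X φ, s => M.Knowable s X {t | φ.Sat M t}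
  | .exactDep X Y, s => M.ExactDep s X Y
  | .condKnow X Y, s => M.CondKnowable s X Y

/-- `φ` and `ψ` are true at the same states of all models in the class `C`. -/
def EquivalentOver (C : Set (TopoDepModel.{u, v, w} (Var := Var) ar))
    (φ : LCD (Var := Var) ar) (ψ : LKk (Var := Var) ar) : Prop :=
  ∀ M ∈ C, ∀ s : M.State, φ.Sat M s ↔ ψ.Sat M s

/-- Some `LCD` formula is equivalent to the `LKk` formula `ψ` over the class `C`. -/
def ExpressibleInLCD (C : Set (TopoDepModel.{u, v, w} (Var := Var) ar))
    (ψ : LKk (Var := Var) ar) : Prop :=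
  ∃ φ : LCD (Var := Var) ar, EquivalentOver C φ ψ

/-- Over the class `C`, `LKk` is strictly more expressive than `LCD`: every `LCD` formula is
equivalent to an `LKk` formula, but not conversely. -/
def LKkStrictlyMoreExpressive (C : Set (TopoDepModel.{u, v, w} (Var := Var) ar)) : Prop :=
  (∀ φ : LCD (Var := Var) ar, ∃ ψ : LKk (Var := Var) ar, EquivalentOver C φ ψ) ∧
    ∃ ψ : LKk (Var := Var) ar, ¬ ExpressibleInLCD C ψ

/-- The class of all topo-dependence models. -/
def topoModels (ar : Pred → ℕ) : Set (TopoDepModel.{u, v, w} (Var := Var) ar) := Set.univ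

/-- The class of metric dependence models. -/
def metricModels (ar : Pred → ℕ) : Set (TopoDepModel.{u, v, w} (Var := Var) ar) :=
  {M | M.IsMetric}

end DepLogic

namespace DepLogic

open Topology Set

/-! ### Dependence atoms in general models; invariance of `LCD` -/

namespace TopoDepModel

variable {Var : Type u} {Pred : Type v} {ar : Pred → ℕ}
  (M : TopoDepModel.{u, v, w} (Var := Var) ar)

/-! If every atom of `LCD` has a constant truth value over a model, so has every formula, since
`D_X` and `K_X` send the empty set and the full set to themselves (`AtomicallyUniform.sat`). It
remains to find such models in which `k_X Y` is true at one state and false at another.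

Topological case: the variables in `X` are constant and all others are one Sierpiński-valued map.
Then `k_X Y` holds at `False`, whose only neighbourhood is the whole space, and fails at `True`.
Metric case: the variables in `X` are the identity of ℝ and all others an involution continuous at 0
only. There `k_X Y` is continuity at the state, whereas `K_A B` asks for continuity on an open set
and cannot single out 0.

For the translation, `K_X Y` is `K_X (k_X Y)`: where `k_X Y` holds on an `X`-open set, `T₀` makes
`Y` a function of `X`, and continuity at each point makes that function continuous. -/

theorem joint_eq_iff {X : Finset Var} {s t : M.State} :
    M.joint X s = M.joint X t ↔ ∀ x ∈ X, M.val x s = M.val x t := by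
  simp [joint, rangeFactorization, funext_iff]

theorem continuous_coord (X : Finset Var) (x : X) :
    Continuous fun v : M.Range X => v.1 x :=
  (continuous_apply x).comp continuous_subtype_val

/-- A map into the range of `X` is continuous if its coordinates are. -/
theorem continuous_joint_comp {T : Type*} [TopologicalSpace T] {X : Finset Var} {g : T → M.State}
    (h : ∀ x ∈ X, Continuous fun r => M.val x (g r)) : Continuous fun r => M.joint X (g r) :=
  Continuous.subtype_mk (continuous_pi fun x : X => h x x.2) _

/-- Epistemic dependence holds as soon as every variable of `Y` is a continuous function of the
joint variable `X`. -/
theorem epistemicDep_of_continuous {X Y : Finset Var} (s : M.State)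
    (h : ∀ y ∈ Y, ∃ f : M.Range X → M.D y, Continuous f ∧ ∀ t, f (M.joint X t) = M.val y t) :
    M.EpistemicDep s X Y := by
  choose f hf hft using h
  refine ⟨univ, @isOpen_univ _ (M.stateTop X), mem_univ s,
    -- `F` reads `Y` at an arbitrary state over `v`; the maps `f` make the choice irrelevant.
    fun v => M.joint Y v.2.choose, ?_, ?_⟩
  · refine M.continuous_joint_comp fun y hy => ?_
    have : (fun r : M.joint X '' univ => M.val y r.2.choose) =
        fun r : M.joint X '' univ => f y hy r.1 := by
      funext r
      rw [← hft y hy, r.2.choose_spec.2]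
    rw [this]
    exact (hf y hy).comp continuous_subtype_val
  · intro t ht
    refine (M.joint_eq_iff).2 fun y hy => ?_
    rw [← hft y hy, ← hft y hy]
    generalize_proofs h
    rw [h.choose_spec.2]

variable {M} in
/-- If `Y` is conditionally knowable given `X` at two states with the same value of `X`, then the
states have the same value of `Y`. -/
theorem CondKnowable.joint_eq {X Y : Finset Var} {s t : M.State} (hs : M.CondKnowable s X Y)
    (ht : M.CondKnowable t X Y) (h : M.joint X s = M.joint X t) : M.joint Y s = M.joint Y t := by
  refine Inseparable.eq (inseparable_iff_forall_isOpen.2 fun U hU => ⟨fun hsU => ?_, fun htU => ?_⟩)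
  · obtain ⟨V, -, hsV, hVU⟩ := hs U hU hsU
    exact hVU (show M.joint X t ∈ V from h ▸ hsV)
  · obtain ⟨V, -, htV, hVU⟩ := ht U hU htU
    exact hVU (show M.joint X s ∈ V from h ▸ htV)

/-- Epistemic dependence is knowable conditional knowability. -/
theorem epistemicDep_iff_knowable_condKnowable (s : M.State) (X Y : Finset Var) :
    M.EpistemicDep s X Y ↔ M.Knowable s X {t | M.CondKnowable t X Y} := by
  constructor
  · rintro ⟨O, hO, hsO, F, hF, hFt⟩
    refine @mem_interior _ (M.stateTop X) _ _ |>.2 ⟨O, fun t ht U hU htU => ?_, hO, hsO⟩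
    obtain ⟨V₀, hV₀, rfl⟩ := isOpen_induced_iff.1 hO
    obtain ⟨V, hV, hVF⟩ := isOpen_induced_iff.1 (hU.preimage hF)
    have key : ∀ r (hr : M.joint X r ∈ V₀), M.joint X r ∈ V ↔ M.joint Y r ∈ U := by
      intro r hr
      have := Set.ext_iff.1 hVF ⟨M.joint X r, mem_image_of_mem _ hr⟩
      rw [mem_preimage, mem_preimage, hFt r hr] at this
      exact this
    -- `V` describes `F⁻¹(U)` only within `𝐗(O)`, hence the intersection with `V₀`.
    exact ⟨V ∩ V₀, hV.inter hV₀, ⟨(key t ht).2 htU, ht⟩, fun r hr => (key r hr.2).1 hr.1⟩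
  · intro h
    obtain ⟨O, hOk, hO, hsO⟩ := (@mem_interior _ (M.stateTop X) _ _).1 h
    have hF : ∀ (v : M.joint X '' O) (t : M.State), t ∈ O → M.joint X t = v.1 →
        M.joint Y v.2.choose = M.joint Y t := fun v t ht htv =>
      (hOk v.2.choose_spec.1).joint_eq (hOk ht) (v.2.choose_spec.2.trans htv.symm)
    refine ⟨O, hO, hsO, fun v => M.joint Y v.2.choose, ?_, fun t ht => hF _ t ht rfl⟩
    refine continuous_def.2 fun U hU => isOpen_iff_forall_mem_open.2 fun v hv => ?_
    obtain ⟨V, hV, hvV, hVU⟩ := hOk v.2.choose_spec.1 U hU hv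
    refine ⟨Subtype.val ⁻¹' V, ?_, hV.preimage continuous_subtype_val, ?_⟩
    · rintro ⟨_, t, ht, rfl⟩ htV
      rw [mem_preimage, hF _ t ht rfl]
      exact hVU htV
    · rw [v.2.choose_spec.2] at hvV
      exact hvV

/-- All states of `M` satisfy the same atomic formulas of `LCD`. -/
structure AtomicallyUniform : Prop where
  atom : ∀ P xs s t, M.HoldsAtom s P xs → M.HoldsAtom t P xs
  exactDep : ∀ X Y s t, M.ExactDep s X Y → M.ExactDep t X Y
  epistemicDep : ∀ X Y s t, M.EpistemicDep s X Y → M.EpistemicDep t X Y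

variable {M} in
theorem AtomicallyUniform.sat (hM : M.AtomicallyUniform) (φ : LCD ar) (s t : M.State) :
    φ.Sat M s → φ.Sat M t := by
  induction φ generalizing s t with
  | atom P xs => exact hM.atom P xs s t
  | neg φ ih => exact mt (ih t s)
  | and φ ψ ihφ ihψ => exact And.imp (ihφ s t) (ihψ s t)
  | det X φ ih => exact fun h r _ => ih s r (h s rfl)
  | know X φ ih =>
    intro h
    have hs := @interior_subset _ (M.stateTop X) _ _ h
    have huniv : {t | φ.Sat M t} = univ := eq_univ_of_forall fun r => ih s r hs
    change t ∈ @interior _ (M.stateTop X) _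
    rw [huniv, @interior_univ _ (M.stateTop X)]
    trivial
  | exactDep X Y => exact hM.exactDep X Y s t
  | epistemicDep X Y => exact hM.epistemicDep X Y s t

end TopoDepModel

/-! ### Inexpressibility criterion and translation into `LKk` -/

section Expressivity

variable {Var : Type u} {Pred : Type v} {ar : Pred → ℕ}

/-- `LCD` does not express a formula whose truth value varies over an atomically uniform model. -/
theorem not_expressibleInLCD {C : Set (TopoDepModel.{u, v, w} (Var := Var) ar)}
    {M : TopoDepModel.{u, v, w} (Var := Var) ar} (hC : M ∈ C) (hM : M.AtomicallyUniform)
    {ψ : LKk ar} {s t : M.State} (hs : ψ.Sat M s) (ht : ¬ ψ.Sat M t) :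
    ¬ ExpressibleInLCD C ψ := fun ⟨φ, hφ⟩ =>
  ht ((hφ M hC t).1 (hM.sat φ s t ((hφ M hC s).2 hs)))

/-- The translation of `LCD` into `LKk`, sending `K_X Y` to `K_X k_X Y`. -/
def LCD.toLKk : LCD (Var := Var) ar → LKk (Var := Var) ar
  | .atom P xs => .atom P xs
  | .neg φ => .neg φ.toLKk
  | .and φ ψ => .and φ.toLKk ψ.toLKk
  | .det X φ => .det X φ.toLKk
  | .know X φ => .know X φ.toLKk
  | .exactDep X Y => .exactDep X Y
  | .epistemicDep X Y => .know X (.condKnow X Y)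

theorem LCD.sat_toLKk (M : TopoDepModel.{u, v, w} (Var := Var) ar) (φ : LCD ar) (s : M.State) :
    φ.toLKk.Sat M s ↔ φ.Sat M s := by
  induction φ generalizing s with
  | atom P xs => exact Iff.rfl
  | neg φ ih => exact not_congr (ih s)
  | and φ ψ ihφ ihψ => exact and_congr (ihφ s) (ihψ s)
  | det X φ ih => simp only [toLKk, LKk.Sat, Sat, ih]
  | know X φ ih => simp only [toLKk, LKk.Sat, Sat, ih]
  | exactDep X Y => exact Iff.rfl
  | epistemicDep X Y => exact (M.epistemicDep_iff_knowable_condKnowable s X Y).symm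

theorem lkkStrictlyMoreExpressive_of_not_expressible
    {C : Set (TopoDepModel.{u, v, w} (Var := Var) ar)} {ψ : LKk ar} (h : ¬ ExpressibleInLCD C ψ) :
    LKkStrictlyMoreExpressive C :=
  ⟨fun φ => ⟨φ.toLKk, fun M _ s => (φ.sat_toLKk M s).symm⟩, ψ, h⟩

end Expressivity

/-! ### The Sierpiński counterexample -/

section Sierpinski

variable {Var : Type u} {Pred : Type v}

/-- Two states; the variables in `X` are constant, the others take values in the Sierpiński
space. -/
abbrev sierpinskiModel (ar : Pred → ℕ) (X : Finset Var) : TopoDepModel.{u, v, w} (Var := Var) ar where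
  -- For `x ∈ X` only `True` remains, which keeps the constant variable surjective.
  D x := ULift.{w} {p : Prop // x ∈ X → p}
  top _ := inferInstance
  t0 _ := Homeomorph.ulift.isEmbedding.t0Space
  I _ := ∅
  State := ULift.{w} Prop
  val x s := ⟨⟨x ∈ X ∨ s.down, Or.inl⟩⟩
  surj x := by
    rintro ⟨⟨p, hp⟩⟩
    refine ⟨⟨p⟩, ?_⟩
    exact congrArg ULift.up (Subtype.ext (propext ⟨fun h => h.elim hp id, Or.inr⟩))

variable {ar : Pred → ℕ} {X : Finset Var}

theorem sierpinskiModel_val_eq_iff {x : Var} {s t : (sierpinskiModel.{u, v, w} ar X).State} :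
    (sierpinskiModel.{u, v, w} ar X).val x s = (sierpinskiModel.{u, v, w} ar X).val x t ↔
      x ∈ X ∨ s = t := by
  obtain ⟨s⟩ := s
  obtain ⟨t⟩ := t
  have : (sierpinskiModel.{u, v, w} ar X).val x ⟨s⟩ = (sierpinskiModel.{u, v, w} ar X).val x ⟨t⟩ ↔
      ((x ∈ X ∨ s) = (x ∈ X ∨ t)) :=
    ULift.ext_iff.trans Subtype.ext_iff
  rw [this]
  by_cases hx : x ∈ X
  · simp [hx]
  · simp only [hx, false_or]
    exact ⟨fun h => h ▸ rfl, fun h => congrArg ULift.down h⟩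

theorem sierpinskiModel_joint_eq_iff {A : Finset Var}
    {s t : (sierpinskiModel.{u, v, w} ar X).State} :
    (sierpinskiModel.{u, v, w} ar X).joint A s = (sierpinskiModel.{u, v, w} ar X).joint A t ↔
      ∀ x ∈ A, x ∈ X ∨ s = t :=
  (TopoDepModel.joint_eq_iff _).trans (forall₂_congr fun _ _ => sierpinskiModel_val_eq_iff)

/-- A variable outside `X` reveals the state and one in `X` reveals nothing. What matters is that
the criterion does not mention `s`. -/
theorem sierpinskiModel_exactDep_iff {s : (sierpinskiModel.{u, v, w} ar X).State}
    {A B : Finset Var} :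
    (sierpinskiModel.{u, v, w} ar X).ExactDep s A B ↔ (∀ b ∈ B, b ∈ X) ∨ ∃ a ∈ A, a ∉ X := by
  refine (forall_congr' fun t => imp_congr sierpinskiModel_joint_eq_iff
    sierpinskiModel_joint_eq_iff).trans ?_
  constructor
  · intro h
    by_contra! hc
    obtain ⟨⟨b, hb, hbX⟩, hA⟩ := hc
    have := (h ⟨¬ s.down⟩ (fun a ha => .inl (hA a ha)) b hb).resolve_left hbX
    have : s.down = ¬ s.down := congrArg ULift.down this
    simp at this
  · rintro (hB | ⟨a, ha, haX⟩) t ht b hb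
    · exact .inl (hB b hb)
    · exact .inr ((ht a ha).resolve_left haX)

/-- An `A`-open set is a union of fibres of `A`, so `F` governs the whole fibre of `s`. -/
theorem TopoDepModel.EpistemicDep.exactDep {M : TopoDepModel.{u, v, w} (Var := Var) ar} {s : M.State}
    {A B : Finset Var} (h : M.EpistemicDep s A B) : M.ExactDep s A B := by
  obtain ⟨O, hO, hsO, F, -, hF⟩ := h
  obtain ⟨V, -, rfl⟩ := isOpen_induced_iff.1 hO
  intro t hst
  have htO : M.joint A t ∈ V := hst ▸ hsO
  rw [← hF s hsO, ← hF t htO]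
  congr 2

/-- Exact dependence is automatically continuous here: a variable is either constant or a copy of
any other variable outside `X`. -/
theorem sierpinskiModel_epistemicDep_iff {s : (sierpinskiModel.{u, v, w} ar X).State}
    {A B : Finset Var} :
    (sierpinskiModel.{u, v, w} ar X).EpistemicDep s A B ↔
      (∀ b ∈ B, b ∈ X) ∨ ∃ a ∈ A, a ∉ X := by
  refine ⟨fun h => sierpinskiModel_exactDep_iff.1 h.exactDep, fun h => ?_⟩
  refine TopoDepModel.epistemicDep_of_continuous _ _ fun b hb => ?_
  by_cases hbX : b ∈ X
  · exact ⟨fun _ => ⟨⟨True, fun _ => trivial⟩⟩, continuous_const,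
      fun t => (sierpinskiModel_val_eq_iff (s := ⟨True⟩) (t := t)).2 (.inl hbX) ▸
        congrArg (fun p => ULift.up p) (Subtype.ext (by simp))⟩
  · obtain ⟨a, ha, haX⟩ := h.resolve_left fun hB => hbX (hB b hb)
    refine ⟨fun v => ⟨⟨(v.1 ⟨a, ha⟩).down.1, fun h => (hbX h).elim⟩⟩, ?_, fun t => ?_⟩
    · refine continuous_uliftUp.comp (Continuous.subtype_mk ?_ _)
      exact continuous_subtype_val.comp (continuous_uliftDown.comp
        (TopoDepModel.continuous_coord _ A ⟨a, ha⟩))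
    · refine congrArg ULift.up (Subtype.ext (propext ?_))
      change (a ∈ X ∨ t.down) ↔ (b ∈ X ∨ t.down)
      simp [haX, hbX]

theorem sierpinskiModel_atomicallyUniform :
    (sierpinskiModel.{u, v, w} ar X).AtomicallyUniform where
  atom _ _ _ _ h := h.elim
  exactDep _ _ _ _ h := sierpinskiModel_exactDep_iff.2 (sierpinskiModel_exactDep_iff.1 h)
  epistemicDep _ _ _ _ h := sierpinskiModel_epistemicDep_iff.2 (sierpinskiModel_epistemicDep_iff.1 h)

theorem sierpinskiModel_condKnowable_false (Y : Finset Var) :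
    (sierpinskiModel.{u, v, w} ar X).CondKnowable ⟨False⟩ X Y := by
  intro U hU h
  refine ⟨univ, isOpen_univ, mem_univ _, fun t _ => ?_⟩
  refine Specializes.mem_open (x := (sierpinskiModel.{u, v, w} ar X).joint Y t) ?_ hU h
  refine (Topology.IsInducing.subtypeVal.specializes_iff).1 (specializes_pi.2 fun y => ?_)
  refine Homeomorph.ulift.isInducing.specializes_iff.1
    (Topology.IsInducing.subtypeVal.specializes_iff.1 ?_)
  change (y.1 ∈ X ∨ t.down) ⤳ (y.1 ∈ X ∨ False)
  by_cases hy : y.1 ∈ X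
  · simp only [hy, true_or]
    exact specializes_rfl
  · rw [Specializes, eq_false (not_or.2 ⟨hy, not_false⟩), nhds_false]
    exact le_top

/-- `{True}` is open, but the constant `X` cannot separate the two states. -/
theorem sierpinskiModel_not_condKnowable_true {Y : Finset Var} (hY : ¬ Y ⊆ X) :
    ¬ (sierpinskiModel.{u, v, w} ar X).CondKnowable ⟨True⟩ X Y := by
  obtain ⟨y, hyY, hyX⟩ := Finset.not_subset.1 hY
  intro h
  have hc : Continuous fun v : (sierpinskiModel.{u, v, w} ar X).Range Y => (v.1 ⟨y, hyY⟩).down.1 :=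
    continuous_subtype_val.comp (continuous_uliftDown.comp
      (TopoDepModel.continuous_coord _ Y ⟨y, hyY⟩))
  obtain ⟨V, -, hV, hVU⟩ := h _ (isOpen_singleton_true.preimage hc) (by
    change (y ∈ X ∨ True) = True
    simp)
  have hFT : (sierpinskiModel.{u, v, w} ar X).joint X ⟨True⟩ =
      (sierpinskiModel.{u, v, w} ar X).joint X ⟨False⟩ :=
    (TopoDepModel.joint_eq_iff _).2 fun x hx => sierpinskiModel_val_eq_iff.2 (.inl hx)
  have : (y ∈ X ∨ False) = True := hVU (show _ ∈ V from hFT ▸ hV)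
  simp [hyX] at this

end Sierpinski

/-! ### Models built from an involution -/

section Involution

variable {Var : Type u} {Pred : Type v} {T : Type w} [TopologicalSpace T]

open Classical in
/-- States and values are points of `T`; the variables in `X` are the identity and all the others
are a fixed involution. -/
noncomputable abbrev involutionModel [T0Space T] (ar : Pred → ℕ) (X : Finset Var) {f : T → T}
    (hf : Function.Involutive f) : TopoDepModel.{u, v, w} (Var := Var) ar where
  D _ := T
  top _ := inferInstance
  t0 _ := inferInstance
  I _ := ∅
  State := T
  val x := if x ∈ X then id else f
  surj x := by
    split_ifs
    exacts [Function.surjective_id, hf.surjective]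

variable [T0Space T] {ar : Pred → ℕ} {X : Finset Var} {f : T → T} {hf : Function.Involutive f}

theorem involutionModel_val_of_mem {x : Var} (hx : x ∈ X) (t : T) :
    (involutionModel ar X hf).val x t = t :=
  congrFun (if_pos hx) t

theorem involutionModel_val_of_notMem {x : Var} (hx : x ∉ X) (t : T) :
    (involutionModel ar X hf).val x t = f t :=
  congrFun (if_neg hx) t

theorem involutionModel_val_injective (x : Var) :
    Function.Injective ((involutionModel ar X hf).val x) := by
  intro s t h
  by_cases hx : x ∈ X
  · rwa [involutionModel_val_of_mem hx, involutionModel_val_of_mem hx] at h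
  · rw [involutionModel_val_of_notMem hx, involutionModel_val_of_notMem hx] at h
    exact hf.injective h

theorem involutionModel_joint_eq_iff {A : Finset Var} {s t : T} :
    (involutionModel ar X hf).joint A s = (involutionModel ar X hf).joint A t ↔
      ∀ x ∈ A, s = t :=
  (TopoDepModel.joint_eq_iff _).trans
    (forall₂_congr fun x _ => (involutionModel_val_injective x).eq_iff)

theorem involutionModel_exactDep_iff [Nontrivial T] {s : T} {A B : Finset Var} :
    (involutionModel ar X hf).ExactDep s A B ↔ A.Nonempty ∨ B = ∅ := by
  refine (forall_congr' fun t => imp_congr involutionModel_joint_eq_iff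
    involutionModel_joint_eq_iff).trans ?_
  constructor
  · intro h
    by_contra! hc
    obtain ⟨rfl, b, hb⟩ := hc
    obtain ⟨t, ht⟩ := exists_ne s
    exact ht (h t (by simp) b hb).symm
  · rintro (⟨a, ha⟩ | rfl) t ht b hb
    · exact ht a ha
    · simp at hb

/-- Passing between `X` and its complement, in either direction, costs one application of `f = f⁻¹`,
which is continuous on no nonempty open set. So each `b` needs some `a` on its own side. -/
theorem involutionModel_epistemicDep_iff
    (hdisc : ∀ W : Set T, IsOpen W → W.Nonempty → ¬ ContinuousOn f W) {s : T} {A B : Finset Var} :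
    (involutionModel ar X hf).EpistemicDep s A B ↔ ∀ b ∈ B, ∃ a ∈ A, (a ∈ X ↔ b ∈ X) := by
  constructor
  · rintro ⟨O, hO, hsO, F, hF, hFt⟩ b hb
    by_contra! hc
    -- All of `A` lies on the side opposite to `b`. At the state `g r` the variables in `A` read `r`
    -- and `b` reads `f r`, so `F` would make `f` continuous on an open set.
    obtain ⟨g, hg, hgA, hgb⟩ : ∃ g : T → T, Function.Involutive g ∧
        (∀ a ∈ A, ∀ t, (involutionModel ar X hf).val a t = g t) ∧
        ∀ t, (involutionModel ar X hf).val b t = f (g t) := by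
      by_cases hbX : b ∈ X
      · refine ⟨f, hf, fun a ha t => involutionModel_val_of_notMem ?_ t, fun t => ?_⟩
        · have := hc a ha
          tauto
        · rw [involutionModel_val_of_mem hbX, hf]
      · refine ⟨id, fun _ => rfl, fun a ha t => involutionModel_val_of_mem ?_ t, fun t => ?_⟩
        · have := hc a ha
          tauto
        · rw [involutionModel_val_of_notMem hbX, id]
    obtain ⟨V, hV, rfl⟩ := isOpen_induced_iff.1 hO
    have hcont : Continuous fun r => (involutionModel ar X hf).joint A (g r) :=
      TopoDepModel.continuous_joint_comp _ fun a ha =>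
        continuous_id.congr fun r => ((hgA a ha (g r)).trans (hg r)).symm
    refine hdisc _ (hV.preimage hcont) ⟨g s, ?_⟩ ?_
    · rw [mem_preimage, hg]
      exact hsO
    · rw [continuousOn_iff_continuous_domRestrict]
      let c : ((fun r => (involutionModel ar X hf).joint A (g r)) ⁻¹' V) →
          ((involutionModel ar X hf).joint A '' ((involutionModel ar X hf).joint A ⁻¹' V)) :=
        fun r => ⟨(involutionModel ar X hf).joint A (g r), mem_image_of_mem _ r.2⟩
      have hc : Continuous c := (hcont.comp continuous_subtype_val).subtype_mk _
      have := ((involutionModel ar X hf).continuous_coord B ⟨b, hb⟩).comp (hF.comp hc)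
      refine this.congr fun r => ?_
      change (F (c r)).1 ⟨b, hb⟩ = f r
      rw [hFt (g r) r.2]
      exact (hgb _).trans (congrArg f (hg _))
  · refine fun h => TopoDepModel.epistemicDep_of_continuous _ _ fun b hb => ?_
    obtain ⟨a, ha, hab⟩ := h b hb
    refine ⟨fun v => v.1 ⟨a, ha⟩, TopoDepModel.continuous_coord _ A ⟨a, ha⟩, fun t => ?_⟩
    change (involutionModel ar X hf).val a t = _
    by_cases hbX : b ∈ X
    · rw [involutionModel_val_of_mem hbX, involutionModel_val_of_mem (hab.2 hbX)]
    · rw [involutionModel_val_of_notMem hbX, involutionModel_val_of_notMem (mt hab.1 hbX)]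

theorem involutionModel_atomicallyUniform [Nontrivial T]
    (hdisc : ∀ W : Set T, IsOpen W → W.Nonempty → ¬ ContinuousOn f W) :
    (involutionModel ar X hf).AtomicallyUniform where
  atom _ _ _ _ h := h.elim
  exactDep _ _ _ _ h := involutionModel_exactDep_iff.2 (involutionModel_exactDep_iff.1 h)
  epistemicDep _ _ _ _ h :=
    (involutionModel_epistemicDep_iff hdisc).2 ((involutionModel_epistemicDep_iff hdisc).1 h)

theorem involutionModel_condKnowable_iff (hX : X.Nonempty) {Y : Finset Var} (hY : ¬ Y ⊆ X) {s : T} :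
    (involutionModel ar X hf).CondKnowable s X Y ↔ ContinuousAt f s := by
  constructor
  · intro h
    obtain ⟨y, hyY, hyX⟩ := Finset.not_subset.1 hY
    refine continuousAt_def.2 fun N hN => ?_
    obtain ⟨U, hUN, hU, hsU⟩ := mem_nhds_iff.1 hN
    obtain ⟨V, hV, hsV, hVU⟩ := h _
      (hU.preimage ((involutionModel ar X hf).continuous_coord Y ⟨y, hyY⟩))
      ((involutionModel_val_of_notMem hyX s).symm ▸ hsU :
        (involutionModel ar X hf).val y s ∈ U)
    have hcont : Continuous fun r : T => (involutionModel ar X hf).joint X r :=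
      TopoDepModel.continuous_joint_comp _ fun x hx =>
        continuous_id.congr fun r => (involutionModel_val_of_mem hx r).symm
    refine mem_nhds_iff.2 ⟨_, fun r hr => hUN ?_, hV.preimage hcont, hsV⟩
    have : (involutionModel ar X hf).val y r ∈ U := hVU hr
    rwa [involutionModel_val_of_notMem hyX] at this
  · intro h U hU hsU
    obtain ⟨x, hx⟩ := hX
    have hcont : ContinuousAt (fun r : T => (involutionModel ar X hf).joint Y r) s := by
      refine Topology.IsInducing.subtypeVal.continuousAt_iff.2 (continuousAt_pi.2 fun y => ?_)
      change ContinuousAt (fun r : T => (involutionModel ar X hf).val y r) s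
      by_cases hy : y.1 ∈ X
      · exact continuousAt_id.congr (.of_forall fun r => (involutionModel_val_of_mem hy r).symm)
      · exact h.congr (.of_forall fun r => (involutionModel_val_of_notMem hy r).symm)
    obtain ⟨W, hWU, hW, hsW⟩ := mem_nhds_iff.1 (hcont.preimage_mem_nhds (hU.mem_nhds hsU))
    refine ⟨_, hW.preimage ((involutionModel ar X hf).continuous_coord X ⟨x, hx⟩), ?_, ?_⟩
    · exact ((involutionModel_val_of_mem hx s).symm ▸ hsW : (involutionModel ar X hf).val x s ∈ W)
    · intro r hr
      have hr' : (involutionModel ar X hf).val x r ∈ W := hr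
      rw [involutionModel_val_of_mem hx] at hr'
      exact hWU hr'

end Involution

/-! ### An involution of ℝ continuous only at 0 -/

section IrrationalReflection

open Classical in
/-- The involution of the real line that fixes the rationals and reflects the irrationals. -/
noncomputable def reflectIrrational (r : ℝ) : ℝ := if Irrational r then -r else r

theorem reflectIrrational_of_irrational {r : ℝ} (hr : Irrational r) : reflectIrrational r = -r :=
  if_pos hr

theorem reflectIrrational_of_not_irrational {r : ℝ} (hr : ¬ Irrational r) :
    reflectIrrational r = r :=
  if_neg hr

theorem reflectIrrational_involutive : Function.Involutive reflectIrrational := by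
  intro r
  by_cases hr : Irrational r
  · rw [reflectIrrational_of_irrational hr, reflectIrrational_of_irrational hr.neg, neg_neg]
  · rw [reflectIrrational_of_not_irrational hr, reflectIrrational_of_not_irrational hr]

/-- Limits along irrationals and along rationals give `-r` and `r`; at 0 the preserved absolute
value gives continuity. -/
theorem continuousAt_reflectIrrational_iff {r : ℝ} :
    ContinuousAt reflectIrrational r ↔ r = 0 := by
  constructor
  · intro h
    have h₁ : (𝓝[{x | Irrational x}] r).NeBot :=
      mem_closure_iff_nhdsWithin_neBot.1 (dense_irrational r)
    have h₂ : (𝓝[range ((↑) : ℚ → ℝ)] r).NeBot :=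
      mem_closure_iff_nhdsWithin_neBot.1 (Rat.denseRange_cast r)
    have e₁ : reflectIrrational r = -r := by
      refine tendsto_nhds_unique (h.mono_left (nhdsWithin_le_nhds (s := {x | Irrational x})))
        (Filter.Tendsto.congr' ?_ ((continuous_neg.tendsto r).mono_left nhdsWithin_le_nhds))
      filter_upwards [self_mem_nhdsWithin] with x hx
      exact (reflectIrrational_of_irrational hx).symm
    have e₂ : reflectIrrational r = r := by
      refine tendsto_nhds_unique (h.mono_left (nhdsWithin_le_nhds (s := range ((↑) : ℚ → ℝ))))
        (Filter.Tendsto.congr' ?_ ((continuous_id.tendsto r).mono_left nhdsWithin_le_nhds))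
      filter_upwards [self_mem_nhdsWithin] with x hx
      exact (reflectIrrational_of_not_irrational fun h => h hx).symm
    linarith
  · rintro rfl
    have habs : ∀ x, |reflectIrrational x| = |x| := by
      intro x
      by_cases hx : Irrational x
      · rw [reflectIrrational_of_irrational hx, abs_neg]
      · rw [reflectIrrational_of_not_irrational hx]
    have h0 : reflectIrrational 0 = 0 := by simpa using habs 0
    rw [ContinuousAt, h0, tendsto_zero_iff_abs_tendsto_zero]
    refine (continuous_abs.tendsto' (0 : ℝ) 0 abs_zero).congr fun x => (habs x).symm

/-- The involution `reflectIrrational` on the copy of the real line in a higher universe. -/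
noncomputable def reflectIrrationalLift (r : ULift.{w} ℝ) : ULift.{w} ℝ :=
  ⟨reflectIrrational r.down⟩

theorem reflectIrrationalLift_involutive : Function.Involutive reflectIrrationalLift.{w} :=
  fun r => congrArg ULift.up (reflectIrrational_involutive r.down)

theorem continuousAt_reflectIrrationalLift_iff {r : ULift.{w} ℝ} :
    ContinuousAt reflectIrrationalLift r ↔ r.down = 0 := by
  rw [← continuousAt_reflectIrrational_iff]
  exact (Homeomorph.ulift.{w}.comp_continuousAt_iff _ r).symm.trans
    (Homeomorph.ulift.{w}.comp_continuousAt_iff' reflectIrrational r)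

theorem not_continuousOn_reflectIrrationalLift {W : Set (ULift.{w} ℝ)} (hW : IsOpen W)
    (hne : W.Nonempty) : ¬ ContinuousOn reflectIrrationalLift W := by
  intro h
  have hW' := hW.preimage continuous_uliftUp
  obtain ⟨r, hrW, hr⟩ := (dense_compl_singleton (0 : ℝ)).inter_open_nonempty _ hW'
    ⟨hne.some.down, hne.some_mem⟩
  exact hr (continuousAt_reflectIrrationalLift_iff.1 (h.continuousAt (hW.mem_nhds hrW)))

end IrrationalReflection

/-! ### Conclusions -/

section Inexpressibility

variable {Var : Type u} {Pred : Type v}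

theorem not_expressibleInLCD_condKnow_topoModels (ar : Pred → ℕ) {X Y : Finset Var}
    (hY : ¬ Y ⊆ X) : ¬ ExpressibleInLCD (topoModels.{u, v, w} ar) (.condKnow X Y) :=
  not_expressibleInLCD (mem_univ _) sierpinskiModel_atomicallyUniform
    (sierpinskiModel_condKnowable_false Y) (sierpinskiModel_not_condKnowable_true hY)

theorem not_expressibleInLCD_condKnow_metricModels (ar : Pred → ℕ) {X Y : Finset Var}
    (hX : X.Nonempty) (hY : ¬ Y ⊆ X) :
    ¬ ExpressibleInLCD (metricModels.{u, v, w} ar) (.condKnow X Y) := by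
  refine not_expressibleInLCD (M := involutionModel ar X reflectIrrationalLift_involutive.{w})
    (show TopoDepModel.IsMetric _ from
      fun _ => (Homeomorph.ulift.{w} (X := ℝ)).isEmbedding.metrizableSpace)
    (involutionModel_atomicallyUniform fun _ => not_continuousOn_reflectIrrationalLift)
    (s := ULift.up (0 : ℝ)) (t := ULift.up (1 : ℝ)) ?_ ?_
  · exact (involutionModel_condKnowable_iff hX hY).2
      (continuousAt_reflectIrrationalLift_iff.2 rfl)
  · exact fun h => one_ne_zero (continuousAt_reflectIrrationalLift_iff.1
      ((involutionModel_condKnowable_iff hX hY).1 h))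

end Inexpressibility

end DepLogic

theorem mainTheorem3 {Var : Type u} {Pred : Type v} (ar : Pred → ℕ) :
    (∀ X Y : Finset Var, ¬ Y ⊆ X →
      ¬ DepLogic.ExpressibleInLCD (DepLogic.topoModels.{u, v, w} ar) (.condKnow X Y)) ∧
    (∀ X Y : Finset Var, X.Nonempty → ¬ Y ⊆ X →
      ¬ DepLogic.ExpressibleInLCD (DepLogic.metricModels.{u, v, w} ar) (.condKnow X Y)) ∧
    (Nonempty Var →
      DepLogic.LKkStrictlyMoreExpressive (DepLogic.topoModels.{u, v, w} (Var := Var) ar)) ∧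
    (Nontrivial Var →
      DepLogic.LKkStrictlyMoreExpressive (DepLogic.metricModels.{u, v, w} (Var := Var) ar)) := by
  refine ⟨fun X Y => DepLogic.not_expressibleInLCD_condKnow_topoModels ar,
    fun X Y => DepLogic.not_expressibleInLCD_condKnow_metricModels ar, ?_, ?_⟩
  · rintro ⟨y⟩
    exact DepLogic.lkkStrictlyMoreExpressive_of_not_expressible
      (DepLogic.not_expressibleInLCD_condKnow_topoModels ar (X := ∅) (Y := {y}) (by simp))
  -- In metric models `k_∅ Y` just says that `Y` is constant, which is `D_∅ Y`; hence a second
  -- variable for `X`.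
  · rintro ⟨x, y, hxy⟩
    exact DepLogic.lkkStrictlyMoreExpressive_of_not_expressible
      (DepLogic.not_expressibleInLCD_condKnow_metricModels ar (X := {x}) (Y := {y})
        (Finset.singleton_nonempty x) (by simpa using hxy.symm))
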